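/- Let $R$ be an integral domain (for instance $\mathbb{Z}$ or a field). A triangulation of a closed homology $n$-manifold (with respect to $R$) is a nonempty finite abstract simplicial complex $K$ of dimension $n$ such that for every $k$-simplex $\sigma$ of $K$, $0\le k\le n$, the link of $\sigma$ has the reduced simplicial homology, with coefficients in $R$, of the sphere $S^{n-k-1}$ (where $S^{-1}=\emptyset$). Such a triangulation is called *rich* if the link of every $(n-2)$-simplex is a simplicial loop of length at least $5$. A simplicial complex is called *flag-no-square* if every nonempty finite set of vertices pairwise connected by edges spans a simplex, and in every simplicial loop of length four some pair of opposite vertices spans an edge. **Corollary 4.4.** For $n\ge 5$, no triangulation of a closed homology $n$-manifold is rich, and in particular no triangulation of a closed homology $n$-manifold is flag-no-square. -/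

import Mathlib

/-!
Finite abstract simplicial complexes, their simplicial homology, closed homology manifolds,
rich triangulations and flag-no-square complexes.

Complexes are Mathlib's `PreAbstractSimplicialComplex ι`: sets of nonempty finite subsets of `ι`,
closed under passing to nonempty subsets; the vertices are the `v` with `{v} ∈ K`.
The linear order on `ι` is used only to orient the simplices in the chain complex.
-/

namespace PreAbstractSimplicialComplex

section Homology

variable {ι : Type*} [LinearOrder ι]

/-- The simplicial boundary operator: a simplex `s = {v₀ < v₁ < ⋯ < vₖ}` is sent to
`∑ i, (-1) ^ i • (s \ {vᵢ})`. The boundary of a vertex is the empty simplex (augmentation) and the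
boundary of the empty simplex is `0`. -/
noncomputable def boundary (R : Type*) [CommRing R] (ι : Type*) [LinearOrder ι] :
    (Finset ι →₀ R) →ₗ[R] (Finset ι →₀ R) :=
  Finsupp.linearCombination R fun s : Finset ι =>
    ∑ v ∈ s, Finsupp.single (s.erase v) ((-1 : R) ^ (s.filter (· < v)).card)

/-- The `R`-module of augmented simplicial chains of `K` spanned by the simplices with exactly `j`
vertices, i.e. the chains of dimension `j - 1`; for `j = 0` the only generator is the empty
simplex. -/
noncomputable def chains (R : Type*) [CommRing R] (K : PreAbstractSimplicialComplex ι) (j : ℕ) :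
    Submodule R (Finset ι →₀ R) :=
  Finsupp.supported R R {s : Finset ι | (s = ∅ ∨ s ∈ K) ∧ s.card = j}

/-- Cycles of dimension `j - 1`. -/
noncomputable def cycles (R : Type*) [CommRing R] (K : PreAbstractSimplicialComplex ι) (j : ℕ) :
    Submodule R (Finset ι →₀ R) :=
  K.chains R j ⊓ LinearMap.ker (boundary R ι)

/-- Boundaries of dimension `j - 1`. -/
noncomputable def boundaries (R : Type*) [CommRing R] (K : PreAbstractSimplicialComplex ι)
    (j : ℕ) : Submodule R (Finset ι →₀ R) :=
  (K.chains R (j + 1)).map (boundary R ι)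

theorem boundary_single (R : Type*) [CommRing R] (s : Finset ι) (a : R) :
    boundary R ι (Finsupp.single s a) =
      ∑ v ∈ s, Finsupp.single (s.erase v) (a * (-1 : R) ^ (s.filter (· < v)).card) := by
  simp [boundary, Finsupp.linearCombination_single, Finset.smul_sum]

/-- The composition of two boundary operators vanishes. -/
theorem boundary_boundary (R : Type*) [CommRing R] (x : Finset ι →₀ R) :
    boundary R ι (boundary R ι x) = 0 := by
  induction x using Finsupp.induction_linear with
  | zero => simp
  | add f g hf hg => simp [map_add, hf, hg]
  | single s a =>
    have key : ∀ v ∈ s, ∀ w ∈ s, v < w →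
        a * (-1 : R) ^ (s.filter (· < v)).card * (-1) ^ ((s.erase v).filter (· < w)).card +
        a * (-1 : R) ^ (s.filter (· < w)).card * (-1) ^ ((s.erase w).filter (· < v)).card
          = 0 := by
      intro v hv w hw hvw
      have h1 : (s.erase w).filter (· < v) = s.filter (· < v) := by
        ext x
        simp only [Finset.mem_filter, Finset.mem_erase]
        exact ⟨fun h => ⟨h.1.2, h.2⟩, fun h => ⟨⟨(h.2.trans hvw).ne, h.1⟩, h.2⟩⟩
      have h2 : (s.filter (· < w)).card = ((s.erase v).filter (· < w)).card + 1 := by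
        rw [Finset.filter_erase, Finset.card_erase_add_one]
        exact Finset.mem_filter.2 ⟨hv, hvw⟩
      rw [h1, h2, pow_succ]
      ring
    rw [boundary_single, map_sum]
    simp_rw [boundary_single]
    rw [Finset.sum_sigma']
    refine Finset.sum_involution (fun p _ => ⟨p.2, p.1⟩) ?_ ?_ ?_ ?_
    · rintro ⟨v, w⟩ h
      simp only [Finset.mem_sigma, Finset.mem_erase] at h
      obtain ⟨hv, hne, hw⟩ := h
      rw [Finset.erase_right_comm (a := w), ← Finsupp.single_add]
      rcases lt_or_gt_of_ne hne with hlt | hlt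
      · rw [add_comm, key w hw v hv hlt, Finsupp.single_zero]
      · rw [key v hv w hw hlt, Finsupp.single_zero]
    · rintro ⟨v, w⟩ h _ heq
      simp only [Finset.mem_sigma, Finset.mem_erase] at h
      simp only [Sigma.mk.injEq] at heq
      exact h.2.1 heq.1
    · rintro ⟨v, w⟩ h
      simp only [Finset.mem_sigma, Finset.mem_erase] at h ⊢
      exact ⟨h.2.2, h.2.1.symm, h.1⟩
    · intros
      rfl

/-- Every boundary is a cycle. -/
theorem boundaries_le_cycles (R : Type*) [CommRing R] (K : PreAbstractSimplicialComplex ι)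
    (j : ℕ) : K.boundaries R j ≤ K.cycles R j := by
  rintro _ ⟨x, hx, rfl⟩
  refine ⟨?_, by simpa using boundary_boundary R x⟩
  have hx' : x ∈ Finsupp.supported R R {s : Finset ι | (s = ∅ ∨ s ∈ K) ∧ s.card = j + 1} := hx
  rw [Finsupp.supported_eq_span_single] at hx'
  suffices h : Submodule.span R ((fun i => Finsupp.single i (1 : R)) ''
      {s : Finset ι | (s = ∅ ∨ s ∈ K) ∧ s.card = j + 1}) ≤
        (K.chains R j).comap (boundary R ι) from h hx'
  rw [Submodule.span_le]
  rintro _ ⟨s, ⟨hs, hcard⟩, rfl⟩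
  simp only [SetLike.mem_coe, Submodule.mem_comap, boundary_single]
  refine Submodule.sum_mem _ fun v hv => Finsupp.single_mem_supported R _ ?_
  refine ⟨?_, by rw [Finset.card_erase_of_mem hv, hcard]; rfl⟩
  rcases (s.erase v).eq_empty_or_nonempty with h | h
  · exact Or.inl h
  · rcases hs with rfl | hs
    · simp at hv
    · exact Or.inr ((K.isRelLowerSet_faces hs).2 (Finset.erase_subset v s) h)

/-- The reduced simplicial homology of `K` in dimension `j - 1` with coefficients in `R`, cycles
modulo boundaries (so that `j = 0` gives the reduced homology in dimension `-1`). The quotient is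
formed as the image of the module of cycles in the quotient of the ambient module by the
boundaries. -/
abbrev ReducedHomology (R : Type*) [CommRing R] (K : PreAbstractSimplicialComplex ι)
    (j : ℕ) : Type _ :=
  (K.cycles R j).map (K.boundaries R j).mkQ

/-- `K` has the reduced `R`-homology of a sphere of dimension `m - 1`: it is `R` in dimension
`m - 1` and zero in all other dimensions. For `m = 0` this is the sphere of dimension `-1`, the
complex without nonempty simplices. -/
def HasHomologyOfSphere (R : Type*) [CommRing R] (m : ℕ)
    (K : PreAbstractSimplicialComplex ι) : Prop :=
  Nonempty (K.ReducedHomology R m ≃ₗ[R] R) ∧ ∀ j, j ≠ m → Subsingleton (K.ReducedHomology R j)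

end Homology

variable {ι : Type*} [DecidableEq ι]

/-- The link of `σ` in `K`: the simplices disjoint from `σ` that together with `σ` span a simplex
of `K`. -/
def link (K : PreAbstractSimplicialComplex ι) (σ : Finset ι) : PreAbstractSimplicialComplex ι where
  faces := {τ | τ.Nonempty ∧ Disjoint τ σ ∧ τ ∪ σ ∈ K.faces}
  isRelLowerSet_faces := by
    rintro τ ⟨hne, hd, hK⟩
    refine ⟨hne, fun ρ hρ hρne => ⟨hρne, Finset.disjoint_of_subset_left hρ hd, ?_⟩⟩
    exact (K.isRelLowerSet_faces hK).2 (Finset.union_subset_union_left hρ)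
      (hρne.mono Finset.subset_union_left)

/-- `K` is (a triangulation of) a closed homology `n`-manifold with respect to coefficients in `R`:
a nonempty finite simplicial complex of dimension `n` in which the link of every `k`-dimensional
simplex, `0 ≤ k ≤ n`, has the homology of a sphere of dimension `n - k - 1`. Since no simplex has a
link with the homology of a ball, there is no boundary. A `k`-simplex `σ` has `k + 1` vertices, so
`HasHomologyOfSphere R (n + 1 - σ.card)` refers to the dimension `n - k - 1`. -/
structure IsClosedHomologyManifold {ι : Type*} [LinearOrder ι] (R : Type*) [CommRing R] (n : ℕ)
    (K : PreAbstractSimplicialComplex ι) : Prop where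
  finite : K.faces.Finite
  nonempty : K.faces.Nonempty
  card_le : ∀ σ ∈ K, σ.card ≤ n + 1
  link_sphere : ∀ σ ∈ K, (K.link σ).HasHomologyOfSphere R (n + 1 - σ.card)

/-- `K` is a simplicial loop of length `m`: its vertices are distinct `v i`, with `i` in `ZMod m`,
and its edges are the pairs `{v i, v (i + 1)}`. -/
def IsLoop (m : ℕ) (K : PreAbstractSimplicialComplex ι) : Prop :=
  3 ≤ m ∧ ∃ v : ZMod m → ι, Function.Injective v ∧
    ∀ s : Finset ι, s ∈ K ↔ (∃ i, s = {v i}) ∨ ∃ i, s = {v i, v (i + 1)}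

/-- A triangulation `K` of a closed `n`-dimensional homology manifold is rich if the links of all
`(n - 2)`-simplices (those with `n - 1` vertices) are loops of length at least `5`. In a manifold
without boundary all simplices are interior. -/
def IsRich (n : ℕ) (K : PreAbstractSimplicialComplex ι) : Prop :=
  ∀ σ ∈ K, σ.card + 1 = n → ∃ m, 5 ≤ m ∧ (K.link σ).IsLoop m

/-- `K` is flag: any finite nonempty set of vertices that are pairwise joined by edges spans a
simplex. -/
def IsFlag (K : PreAbstractSimplicialComplex ι) : Prop :=
  ∀ s : Finset ι, s.Nonempty → (∀ v ∈ s, {v} ∈ K) →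
    (∀ v ∈ s, ∀ w ∈ s, v ≠ w → {v, w} ∈ K) → s ∈ K

/-- `K` has no squares: in each simplicial loop of length four in `K`, with consecutive vertices
`v 0, v 1, v 2, v 3`, a pair of opposite vertices spans an edge. -/
def HasNoSquare (K : PreAbstractSimplicialComplex ι) : Prop :=
  ∀ v : ZMod 4 → ι, Function.Injective v → (∀ i, {v i, v (i + 1)} ∈ K) →
    {v 0, v 2} ∈ K ∨ {v 1, v 3} ∈ K

/-- `K` is flag-no-square. -/
def IsFlagNoSquare (K : PreAbstractSimplicialComplex ι) : Prop :=
  K.IsFlag ∧ K.HasNoSquare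

end PreAbstractSimplicialComplex

namespace PreAbstractSimplicialComplex

/-! The argument is a local count. As `n ≥ 5`, there is a nonempty simplex `σ` with `n - 4`
vertices; its link is a homology 4-sphere. Let `f_j` count the simplices of that link with `j`
vertices. Euler's relation for the link, together with its sums over the links of edges and of
3-simplices, gives `f_3 + 4 = 2 f_1 + 2 f_5` (`card_cofaces_three`).

If the link in `K` of every `(n-2)`-simplex had at least five edges, then counting triangles inside
4-simplices would give `5 f_3 ≤ 10 f_5`. Hence `f_1 ≤ 2`, whereas a single 4-simplex already has
five vertices. So some `(n-2)`-simplex has fewer than five edges in its link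
(`exists_card_cofaces_two_lt`).

Both properties contradict this. A loop of length `m` has `m` edges. In a flag-no-square manifold
the link of an `(n-2)`-simplex has as many edges as vertices by Euler's relation, and a path inside
it exhibits five distinct vertices. -/

theorem mem_of_subset {ι : Type*} {K : PreAbstractSimplicialComplex ι} {σ τ : Finset ι}
    (hσ : σ ∈ K) (h : τ ⊆ σ) (hτ : τ.Nonempty) : τ ∈ K :=
  (K.isRelLowerSet_faces hσ).2 h hτ

theorem nonempty_of_mem {ι : Type*} {K : PreAbstractSimplicialComplex ι} {σ : Finset ι}
    (hσ : σ ∈ K) : σ.Nonempty :=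
  (K.isRelLowerSet_faces hσ).1

theorem finite_setOf_card_eq {ι : Type*} {L : PreAbstractSimplicialComplex ι}
    (hL : L.faces.Finite) (j : ℕ) :
    {s : Finset ι | (s = ∅ ∨ s ∈ L) ∧ s.card = j}.Finite :=
  (hL.insert ∅).subset fun _ h => h.1

/-! ### Rank-nullity over a domain and the Euler–Poincaré formula -/

section EulerPoincare

open Module

theorem cycles_zero {R : Type*} [CommRing R] {ι : Type*} [LinearOrder ι]
    {L : PreAbstractSimplicialComplex ι} : L.cycles R 0 = L.chains R 0 := by
  refine inf_eq_left.2 fun x hx => ?_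
  have hx' : x ∈ Finsupp.supported R R {s : Finset ι | (s = ∅ ∨ s ∈ L) ∧ s.card = 0} := hx
  rw [Finsupp.mem_supported] at hx'
  rw [LinearMap.mem_ker, ← Finsupp.sum_single x, Finsupp.sum, map_sum]
  refine Finset.sum_eq_zero fun s hs => ?_
  rw [Finset.card_eq_zero.1 (hx' hs).2, boundary_single, Finset.sum_empty]

universe u v

variable {R : Type u} [CommRing R] [IsDomain R]

/-- Rank-nullity holds over any domain, without freeness. The finiteness hypothesis lets the
cardinal identity descend to `ℕ`. -/
theorem finrank_map_add_finrank_inf_ker {M N : Type*} [AddCommGroup M] [AddCommGroup N]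
    [Module R M] [Module R N] (f : M →ₗ[R] N) (p : Submodule R M)
    (hp : Module.rank R p < Cardinal.aleph0) :
    finrank R (p.map f) + finrank R (p ⊓ LinearMap.ker f : Submodule R M) = finrank R p := by
  have key := LinearMap.lift_rank_range_add_rank_ker (f.domRestrict p)
  have e : LinearMap.ker (f.domRestrict p) ≃ₗ[R] (p ⊓ LinearMap.ker f : Submodule R M) := by
    have h : LinearMap.ker (f.domRestrict p) = (p ⊓ LinearMap.ker f).comap p.subtype := by
      ext x; simp
    rw [h]
    exact Submodule.comapSubtypeEquivOfLe inf_le_left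
  have hr : LinearMap.range (f.domRestrict p) = p.map f := by
    ext x; simp
  have h := congrArg Cardinal.toNat key
  rw [Cardinal.toNat_add] at h
  · rw [Cardinal.toNat_lift, Cardinal.toNat_lift, Cardinal.toNat_lift, hr] at h
    rw [← e.finrank_eq]
    exact h
  · refine lt_of_le_of_lt (le_add_of_nonneg_right zero_le) (key.trans_lt ?_)
    simpa using hp
  · refine lt_of_le_of_lt (le_add_of_nonneg_left zero_le) (key.trans_lt ?_)
    simpa using hp

variable {ι : Type v} (L : PreAbstractSimplicialComplex ι)

variable (R) in
theorem lift_rank_chains (j : ℕ) : Cardinal.lift.{v} (Module.rank R (L.chains R j)) =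
    Cardinal.lift.{max u v} (Cardinal.mk {s : Finset ι | (s = ∅ ∨ s ∈ L) ∧ s.card = j}) := by
  have h := (Finsupp.supportedEquivFinsupp (M := R) (R := R)
    {s : Finset ι | (s = ∅ ∨ s ∈ L) ∧ s.card = j}).lift_rank_eq
  rw [rank_finsupp_self] at h
  have h' := congrArg Cardinal.lift.{v} h
  simp only [Cardinal.lift_lift, Cardinal.lift_id] at h'
  exact h'

theorem finrank_chains (j : ℕ) : finrank R (L.chains R j) =
    {s : Finset ι | (s = ∅ ∨ s ∈ L) ∧ s.card = j}.ncard := by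
  have h := congrArg Cardinal.toNat (lift_rank_chains R L j)
  rw [Cardinal.toNat_lift, Cardinal.toNat_lift] at h
  exact h

variable {L}

theorem rank_chains_lt_aleph0 (hL : L.faces.Finite) (j : ℕ) :
    Module.rank R (L.chains R j) < Cardinal.aleph0 := by
  rw [← Cardinal.lift_lt_aleph0, lift_rank_chains, Cardinal.lift_lt_aleph0]
  exact Cardinal.lt_aleph0_iff_set_finite.2 (finite_setOf_card_eq hL j)

variable [LinearOrder ι]

theorem finrank_boundaries_add_finrank_cycles_succ (hL : L.faces.Finite) (j : ℕ) :
    finrank R (L.boundaries R j) + finrank R (L.cycles R (j + 1)) =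
      finrank R (L.chains R (j + 1)) :=
  finrank_map_add_finrank_inf_ker _ _ (rank_chains_lt_aleph0 hL _)

theorem finrank_homology_add_finrank_boundaries (hL : L.faces.Finite) (j : ℕ) :
    finrank R (L.ReducedHomology R j) + finrank R (L.boundaries R j) =
      finrank R (L.cycles R j) := by
  have h := finrank_map_add_finrank_inf_ker (L.boundaries R j).mkQ (L.cycles R j)
    ((Submodule.rank_mono inf_le_left).trans_lt (rank_chains_lt_aleph0 hL j))
  rwa [Submodule.ker_mkQ, inf_eq_right.2 (boundaries_le_cycles R L j)] at h

/-- The alternating sum telescopes; truncating it at `k` leaves the rank of the boundaries coming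
from chains on `k + 1` vertices. -/
theorem sum_finrank_chains (hL : L.faces.Finite) (k : ℕ) :
    ∑ j ∈ Finset.range (k + 1), (-1 : ℤ) ^ j * finrank R (L.chains R j) =
      (-1) ^ k * finrank R (L.boundaries R k) +
        ∑ j ∈ Finset.range (k + 1), (-1 : ℤ) ^ j * finrank R (L.ReducedHomology R j) := by
  induction k with
  | zero =>
    have h := finrank_homology_add_finrank_boundaries (R := R) hL 0
    have hz : finrank R (L.cycles R 0) = finrank R (L.chains R 0) := by rw [cycles_zero]
    simp only [zero_add, Finset.sum_range_one, pow_zero, one_mul]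
    omega
  | succ k ih =>
    rw [Finset.sum_range_succ, ih, Finset.sum_range_succ _ (k + 1),
      ← finrank_boundaries_add_finrank_cycles_succ hL k,
      ← finrank_homology_add_finrank_boundaries hL (k + 1)]
    push_cast
    ring

theorem HasHomologyOfSphere.finrank_eq {m : ℕ} (h : L.HasHomologyOfSphere R m) (j : ℕ) :
    finrank R (L.ReducedHomology R j) = if j = m then 1 else 0 := by
  split_ifs with hj
  · subst hj
    obtain ⟨e⟩ := h.1
    rw [e.finrank_eq, finrank_self]
  · have := h.2 j hj
    exact finrank_zero_of_subsingleton

/-- The Euler–Poincaré formula for complexes with the homology of a sphere. -/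
theorem HasHomologyOfSphere.euler {m : ℕ} (h : L.HasHomologyOfSphere R m)
    (hL : L.faces.Finite) (hcard : ∀ s ∈ L, s.card ≤ m) :
    ∑ j ∈ Finset.range (m + 1),
      (-1 : ℤ) ^ j * {s : Finset ι | (s = ∅ ∨ s ∈ L) ∧ s.card = j}.ncard = (-1) ^ m := by
  -- No simplex has `m + 1` vertices, so the truncation term vanishes.
  have hB : finrank R (L.boundaries R m) = 0 := by
    have h1 := finrank_boundaries_add_finrank_cycles_succ (R := R) hL m
    have h2 : {s : Finset ι | (s = ∅ ∨ s ∈ L) ∧ s.card = m + 1} = ∅ := by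
      ext s
      simp only [Set.mem_ofPred_eq, Set.mem_empty_iff_false, iff_false]
      rintro ⟨rfl | hs, hc⟩
      · simp at hc
      · have := hcard s hs
        omega
    rw [finrank_chains, h2, Set.ncard_empty] at h1
    omega
  simp_rw [← finrank_chains (R := R)]
  rw [sum_finrank_chains hL, hB]
  simp_rw [h.finrank_eq]
  simp

/-- Homology of rank one in degree `m` needs a nonzero chain there. -/
theorem HasHomologyOfSphere.exists_card_eq {m : ℕ} (h : L.HasHomologyOfSphere R m)
    (hL : L.faces.Finite) : ∃ s : Finset ι, (s = ∅ ∨ s ∈ L) ∧ s.card = m := by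
  by_contra hne
  have h0 : {s : Finset ι | (s = ∅ ∨ s ∈ L) ∧ s.card = m} = ∅ :=
    Set.eq_empty_iff_forall_notMem.2 fun s hs => hne ⟨s, hs⟩
  have h1 : finrank R (L.chains R m) = 0 := by rw [finrank_chains, h0, Set.ncard_empty]
  have h2 := finrank_map_add_finrank_inf_ker (boundary R ι) (L.chains R m)
    (rank_chains_lt_aleph0 hL m)
  have h3 : finrank R (L.ReducedHomology R m) + finrank R (L.boundaries R m) =
      finrank R (L.chains R m ⊓ LinearMap.ker (boundary R ι) : Submodule R _) :=
    finrank_homology_add_finrank_boundaries hL m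
  rw [h.finrank_eq, if_pos rfl] at h3
  omega

end EulerPoincare

/-! ### Counting simplices of links as cofaces -/

section Cofaces

variable {ι : Type*} [LinearOrder ι]

/-- The simplices of the finite family `F` that contain `σ` and have `j` further vertices. -/
def cofaces (F : Finset (Finset ι)) (σ : Finset ι) (j : ℕ) : Finset (Finset ι) :=
  F.filter fun ρ => σ ⊆ ρ ∧ ρ.card = σ.card + j

theorem mem_cofaces {F : Finset (Finset ι)} {σ ρ : Finset ι} {j : ℕ} :
    ρ ∈ cofaces F σ j ↔ ρ ∈ F ∧ σ ⊆ ρ ∧ ρ.card = σ.card + j := Finset.mem_filter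

variable {K : PreAbstractSimplicialComplex ι}

theorem mem_link {σ τ : Finset ι} :
    τ ∈ K.link σ ↔ τ.Nonempty ∧ Disjoint τ σ ∧ τ ∪ σ ∈ K := Iff.rfl

theorem link_finite (hK : K.faces.Finite) (σ : Finset ι) : (K.link σ).faces.Finite := by
  refine Set.Finite.of_finite_image (f := (· ∪ σ)) (hK.subset ?_) ?_
  · rintro _ ⟨τ, hτ, rfl⟩
    exact hτ.2.2
  · intro τ hτ τ' hτ' h
    have h' : τ ∪ σ = τ' ∪ σ := h
    rw [← Finset.union_sdiff_cancel_right hτ.2.1, h', Finset.union_sdiff_cancel_right hτ'.2.1]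

theorem ncard_link_eq_card_cofaces {F : Finset (Finset ι)} (hF : ∀ s, s ∈ F ↔ s ∈ K)
    {σ : Finset ι} (hσ : σ ∈ K) (j : ℕ) :
    {s : Finset ι | (s = ∅ ∨ s ∈ K.link σ) ∧ s.card = j}.ncard = (cofaces F σ j).card := by
  rw [← Set.ncard_coe_finset]
  have hd : ∀ s : Finset ι, (s = ∅ ∨ s ∈ K.link σ) → Disjoint s σ := by
    rintro s (rfl | hs)
    · simp
    · exact hs.2.1
  refine Set.ncard_congr (fun s _ => s ∪ σ) ?_ ?_ ?_
  · rintro s ⟨hs, hc⟩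
    rw [Finset.mem_coe, mem_cofaces, Finset.card_union_of_disjoint (hd s hs), hc, add_comm, hF]
    refine ⟨?_, Finset.subset_union_right, rfl⟩
    rcases hs with rfl | hs
    · simpa using hσ
    · exact hs.2.2
  · intro s t hs ht h
    rw [← Finset.union_sdiff_cancel_right (hd s hs.1), h,
      Finset.union_sdiff_cancel_right (hd t ht.1)]
  · intro ρ hρ
    rw [Finset.mem_coe, mem_cofaces, hF] at hρ
    refine ⟨ρ \ σ, ⟨?_, ?_⟩, Finset.sdiff_union_of_subset hρ.2.1⟩
    · rcases (ρ \ σ).eq_empty_or_nonempty with h | h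
      · exact Or.inl h
      · refine Or.inr (mem_link.2 ⟨h, Finset.sdiff_disjoint, ?_⟩)
        rw [Finset.sdiff_union_of_subset hρ.2.1]
        exact hρ.1
    · rw [Finset.card_sdiff_of_subset hρ.2.1]
      omega

theorem card_cofaces_zero {F : Finset (Finset ι)} {σ : Finset ι} (hσ : σ ∈ F) :
    (cofaces F σ 0).card = 1 := by
  rw [Finset.card_eq_one]
  refine ⟨σ, ?_⟩
  ext ρ
  rw [mem_cofaces, Finset.mem_singleton]
  constructor
  · rintro ⟨-, h, hc⟩
    exact (Finset.eq_of_subset_of_card_le h (by omega)).symm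
  · rintro rfl
    exact ⟨hσ, subset_rfl, rfl⟩

/-- Each coface of `σ` with `i + j` further vertices has `(i + j).choose i` faces that contain `σ`
and have `i` further vertices. -/
theorem sum_card_cofaces {F : Finset (Finset ι)} (hF : ∀ s, s ∈ F ↔ s ∈ K)
    {σ : Finset ι} (hσ : σ ∈ K) (i j : ℕ) :
    ∑ τ ∈ cofaces F σ i, (cofaces F τ j).card =
      (i + j).choose i * (cofaces F σ (i + j)).card := by
  have h := Finset.sum_card_bipartiteAbove_eq_sum_card_bipartiteBelow
    (s := cofaces F σ i) (t := cofaces F σ (i + j)) (fun τ ρ => τ ⊆ ρ)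
  have h1 : ∀ τ ∈ cofaces F σ i,
      (cofaces F σ (i + j)).bipartiteAbove (fun τ ρ => τ ⊆ ρ) τ = cofaces F τ j := by
    intro τ hτ
    rw [mem_cofaces] at hτ
    ext ρ
    simp only [Finset.bipartiteAbove, Finset.mem_filter, mem_cofaces]
    constructor
    · rintro ⟨⟨ha, hb, hc⟩, hd⟩
      exact ⟨ha, hd, by omega⟩
    · rintro ⟨ha, hb, hc⟩
      exact ⟨⟨ha, hτ.2.1.trans hb, by omega⟩, hb⟩
  have h2 : ∀ ρ ∈ cofaces F σ (i + j),
      ((cofaces F σ i).bipartiteBelow (fun τ ρ => τ ⊆ ρ) ρ).card = (i + j).choose i := by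
    intro ρ hρ
    rw [mem_cofaces, hF] at hρ
    have hc : (ρ \ σ).card = i + j := by
      rw [Finset.card_sdiff_of_subset hρ.2.1]
      omega
    rw [← hc, ← Finset.card_powersetCard]
    refine Finset.card_nbij' (· \ σ) (· ∪ σ) ?_ ?_ ?_ ?_
    · intro τ hτ
      simp only [Finset.bipartiteBelow, Finset.coe_filter, mem_cofaces, Set.mem_ofPred_eq] at hτ
      simp only [Finset.mem_coe, Finset.mem_powersetCard]
      refine ⟨Finset.sdiff_subset_sdiff hτ.2 subset_rfl, ?_⟩
      rw [Finset.card_sdiff_of_subset hτ.1.2.1]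
      omega
    · intro τ hτ
      simp only [Finset.mem_coe, Finset.mem_powersetCard] at hτ
      simp only [Finset.bipartiteBelow, Finset.coe_filter, mem_cofaces, Set.mem_ofPred_eq, hF]
      have hs : τ ∪ σ ⊆ ρ :=
        Finset.union_subset (hτ.1.trans Finset.sdiff_subset) hρ.2.1
      refine ⟨⟨mem_of_subset hρ.1 hs ((nonempty_of_mem hσ).mono Finset.subset_union_right),
        Finset.subset_union_right, ?_⟩, hs⟩
      rw [Finset.card_union_of_disjoint
        (Finset.disjoint_of_subset_left hτ.1 Finset.sdiff_disjoint)]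
      omega
    · intro τ hτ
      simp only [Finset.bipartiteBelow, Finset.coe_filter, mem_cofaces, Set.mem_ofPred_eq] at hτ
      exact Finset.sdiff_union_of_subset hτ.1.2.1
    · intro τ hτ
      simp only [Finset.mem_coe, Finset.mem_powersetCard] at hτ
      exact Finset.union_sdiff_cancel_right
        (Finset.disjoint_of_subset_left hτ.1 Finset.sdiff_disjoint)
  rw [Finset.sum_congr rfl fun τ hτ => by rw [h1 τ hτ], Finset.sum_congr rfl h2,
    Finset.sum_const, smul_eq_mul, mul_comm] at h
  exact h

end Cofaces

end PreAbstractSimplicialComplex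

namespace PreAbstractSimplicialComplex

/-! ### Face numbers of links in a homology manifold -/

section Manifold

variable {R : Type*} [CommRing R] [IsDomain R] {ι : Type*} [LinearOrder ι] {n : ℕ}
  {K : PreAbstractSimplicialComplex ι} {F : Finset (Finset ι)}

theorem IsClosedHomologyManifold.euler_cofaces (hK : K.IsClosedHomologyManifold R n)
    (hF : ∀ s, s ∈ F ↔ s ∈ K) {σ : Finset ι} (hσ : σ ∈ K) {m : ℕ} (hm : σ.card + m = n + 1) :
    ∑ j ∈ Finset.range (m + 1), (-1 : ℤ) ^ j * (cofaces F σ j).card = (-1) ^ m := by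
  have h := hK.link_sphere σ hσ
  rw [show n + 1 - σ.card = m by omega] at h
  rw [← h.euler (link_finite hK.finite σ)]
  · simp_rw [ncard_link_eq_card_cofaces hF hσ]
  · intro s hs
    have h1 := hK.card_le _ (mem_link.1 hs).2.2
    rw [Finset.card_union_of_disjoint (mem_link.1 hs).2.1] at h1
    omega

/-- Purity: the top homology of the link of `σ` forces a simplex of full dimension there, the empty
one if `σ` is itself a facet. -/
theorem IsClosedHomologyManifold.exists_facet (hK : K.IsClosedHomologyManifold R n)
    {σ : Finset ι} (hσ : σ ∈ K) : ∃ ρ ∈ K, σ ⊆ ρ ∧ ρ.card = n + 1 := by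
  obtain ⟨s, hs, hc⟩ := (hK.link_sphere σ hσ).exists_card_eq (link_finite hK.finite σ)
  have hle := hK.card_le σ hσ
  rcases hs with rfl | hs
  · refine ⟨σ, hσ, subset_rfl, ?_⟩
    rw [Finset.card_empty] at hc
    omega
  · refine ⟨s ∪ σ, hs.2.2, Finset.subset_union_right, ?_⟩
    rw [Finset.card_union_of_disjoint hs.2.1]
    omega

/-- The relation between the face numbers of the link of a simplex of codimension five, which has
the homology of the four-dimensional sphere. -/
theorem IsClosedHomologyManifold.card_cofaces_three (hK : K.IsClosedHomologyManifold R n)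
    (hF : ∀ s, s ∈ F ↔ s ∈ K) {σ : Finset ι} (hσ : σ ∈ K) (hc : σ.card + 5 = n + 1) :
    (cofaces F σ 3).card + 4 = 2 * (cofaces F σ 1).card + 2 * (cofaces F σ 5).card := by
  have hmem : ∀ {j : ℕ} {τ : Finset ι}, τ ∈ cofaces F σ j → τ ∈ K ∧ τ.card = σ.card + j := by
    intro j τ hτ
    rw [mem_cofaces, hF] at hτ
    exact ⟨hτ.1, hτ.2.2⟩
  have hsum : ∀ i j : ℕ, ∑ τ ∈ cofaces F σ i, ((cofaces F τ j).card : ℤ) =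
      (i + j).choose i * ((cofaces F σ (i + j)).card : ℤ) := by
    intro i j
    exact_mod_cast sum_card_cofaces hF hσ i j
  -- With `f_j` as the number of cofaces, the three relations are `1 - f_1 + f_2 - f_3 + f_4 - f_5 =
  -- -1`, `2 f_2 = 3 f_3 - 6 f_4 + 10 f_5` and `2 f_4 = 5 f_5`; eliminating `f_2` and `f_4` gives
  -- the claim.
  have h0 := hK.euler_cofaces hF hσ hc
  simp only [Finset.sum_range_succ, Finset.sum_range_zero,
    card_cofaces_zero ((hF σ).2 hσ)] at h0
  have h2 : ∑ τ ∈ cofaces F σ 2, ∑ j ∈ Finset.range (3 + 1),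
      (-1 : ℤ) ^ j * (cofaces F τ j).card = ∑ τ ∈ cofaces F σ 2, (-1) ^ 3 :=
    Finset.sum_congr rfl fun τ hτ =>
      hK.euler_cofaces hF (hmem hτ).1 (by have := (hmem hτ).2; omega)
  have h4 : ∑ τ ∈ cofaces F σ 4, ∑ j ∈ Finset.range (1 + 1),
      (-1 : ℤ) ^ j * (cofaces F τ j).card = ∑ τ ∈ cofaces F σ 4, (-1) ^ 1 :=
    Finset.sum_congr rfl fun τ hτ =>
      hK.euler_cofaces hF (hmem hτ).1 (by have := (hmem hτ).2; omega)
  rw [Finset.sum_comm] at h2 h4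
  simp_rw [← Finset.mul_sum, hsum] at h2 h4
  simp only [Finset.sum_range_succ, Finset.sum_range_zero, Finset.sum_const] at h2 h4
  norm_num [Nat.choose] at h0 h2 h4
  omega

theorem IsClosedHomologyManifold.exists_card_cofaces_two_lt
    (hK : K.IsClosedHomologyManifold R n) (hn : 5 ≤ n) (hF : ∀ s, s ∈ F ↔ s ∈ K) :
    ∃ σ ∈ K, σ.card + 1 = n ∧ (cofaces F σ 2).card < 5 := by
  by_contra! hge
  obtain ⟨τ, hτ⟩ := hK.nonempty
  obtain ⟨ρ, hρ, -, hρc⟩ := hK.exists_facet hτ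
  -- Here `5 ≤ n` makes `σ` nonempty, so that the link condition applies to it.
  obtain ⟨σ, hσρ, hσc⟩ := Finset.exists_subset_card_eq (s := ρ) (n := n - 4) (by omega)
  have hσ : σ ∈ K := mem_of_subset hρ hσρ (Finset.card_pos.1 (by omega))
  have h3 := hK.card_cofaces_three hF hσ (by omega)
  have h5 := sum_card_cofaces hF hσ 3 2
  have hle : 5 * (cofaces F σ 3).card ≤ ∑ τ ∈ cofaces F σ 3, (cofaces F τ 2).card := by
    rw [mul_comm, ← smul_eq_mul]
    refine Finset.card_nsmul_le_sum _ _ _ fun τ hτ => ?_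
    rw [mem_cofaces, hF] at hτ
    exact hge τ hτ.1 (by omega)
  -- The five vertices of the facet `ρ` outside `σ` lie in the link.
  have h1 : (ρ \ σ).card ≤ (cofaces F σ 1).card := by
    refine Finset.card_le_card_of_injOn (fun x => insert x σ) ?_ ?_
    · intro x hx
      rw [Finset.mem_coe, Finset.mem_sdiff] at hx
      rw [Finset.mem_coe, mem_cofaces, hF]
      exact ⟨mem_of_subset hρ (Finset.insert_subset hx.1 hσρ) (Finset.insert_nonempty _ _),
        Finset.subset_insert _ _, Finset.card_insert_of_notMem hx.2⟩
    · intro x hx y hy h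
      exact (Finset.insert_inj (Finset.mem_sdiff.1 hx).2).1 h
  rw [Finset.card_sdiff_of_subset hσρ] at h1
  norm_num [Nat.choose] at h5
  omega

end Manifold

/-! ### Rich triangulations: edges of a loop -/

section Loops

variable {ι : Type*} [LinearOrder ι] {K : PreAbstractSimplicialComplex ι}
  {F : Finset (Finset ι)}

theorem IsLoop.le_ncard_edges {m : ℕ} {L : PreAbstractSimplicialComplex ι} (hL : L.IsLoop m)
    (hfin : L.faces.Finite) :
    m ≤ {s : Finset ι | (s = ∅ ∨ s ∈ L) ∧ s.card = 2}.ncard := by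
  obtain ⟨hm, v, hv, hs⟩ := hL
  have : NeZero m := ⟨by omega⟩
  have : Fact (1 < m) := ⟨by omega⟩
  -- If `2 = 0`, the edges at `i` and `i + 1` would coincide; `3 ≤ m` excludes this.
  have h2 : (2 : ZMod m) ≠ 0 := by
    intro h
    have h' : ((2 : ℕ) : ZMod m) = 0 := by exact_mod_cast h
    rw [ZMod.natCast_eq_zero_iff] at h'
    have := Nat.le_of_dvd (by norm_num) h'
    omega
  have hinj : Function.Injective fun i : ZMod m => ({v i, v (i + 1)} : Finset ι) := by
    intro i j h
    have hi : v i ∈ ({v j, v (j + 1)} : Finset ι) := by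
      simp only at h
      rw [← h]
      simp
    have hi' : v (i + 1) ∈ ({v j, v (j + 1)} : Finset ι) := by
      simp only at h
      rw [← h]
      simp
    simp only [Finset.mem_insert, Finset.mem_singleton, hv.eq_iff] at hi hi'
    rcases hi with hi | hi
    · exact hi
    · rcases hi' with hi' | hi'
      · exact absurd (by linear_combination hi' - hi) h2
      · simpa using hi'
  calc m = (Set.range fun i : ZMod m => ({v i, v (i + 1)} : Finset ι)).ncard := by
        rw [← Set.image_univ, Set.ncard_image_of_injective _ hinj, Set.ncard_univ, Nat.card_zmod]
    _ ≤ _ := by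
        refine Set.ncard_le_ncard ?_ (finite_setOf_card_eq hfin 2)
        rintro _ ⟨i, rfl⟩
        refine ⟨Or.inr ((hs _).2 (Or.inr ⟨i, rfl⟩)), Finset.card_pair fun h => ?_⟩
        simpa using hv h

theorem IsRich.five_le_card_cofaces {n : ℕ} (h : K.IsRich n) (hK : K.faces.Finite)
    (hF : ∀ s, s ∈ F ↔ s ∈ K) {σ : Finset ι} (hσ : σ ∈ K) (hc : σ.card + 1 = n) :
    5 ≤ (cofaces F σ 2).card := by
  obtain ⟨m, hm, hL⟩ := h σ hσ hc
  rw [← ncard_link_eq_card_cofaces hF hσ]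
  exact hm.trans (hL.le_ncard_edges (link_finite hK σ))

end Loops

/-! ### Flag-no-square manifolds: five vertices in each codimension-two link -/

section FlagNoSquare

variable {R : Type*} [CommRing R] [IsDomain R] {ι : Type*} [LinearOrder ι] {n : ℕ}
  {K : PreAbstractSimplicialComplex ι} {F : Finset (Finset ι)}

theorem IsFlag.insert_three_mem {ι : Type*} [DecidableEq ι] {K : PreAbstractSimplicialComplex ι}
    (hK : K.IsFlag) {σ : Finset ι} {a b c : ι}
    (ha : insert a σ ∈ K) (hb : insert b σ ∈ K) (hc : insert c σ ∈ K)
    (hab : {a, b} ∈ K) (hbc : {b, c} ∈ K) (hac : {a, c} ∈ K) :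
    insert a (insert b (insert c σ)) ∈ K := by
  have edge : ∀ x, insert x σ ∈ K → ∀ v ∈ insert x σ, ∀ w ∈ insert x σ, {v, w} ∈ K :=
    fun x hx v hv w hw => mem_of_subset hx
      (Finset.insert_subset hv (Finset.singleton_subset_iff.2 hw)) (Finset.insert_nonempty _ _)
  -- The case `v = w` is included: it supplies the vertex condition of flagness.
  have hpair : ∀ v ∈ insert a (insert b (insert c σ)), ∀ w ∈ insert a (insert b (insert c σ)),
      {v, w} ∈ K := by
    have ea := edge a ha
    have eb := edge b hb
    have ec := edge c hc
    have hba := hab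
    have hcb := hbc
    have hca := hac
    rw [Finset.pair_comm] at hba hcb hca
    simp only [Finset.mem_insert] at ea eb ec ⊢
    rintro v (rfl | rfl | rfl | hv) w (rfl | rfl | rfl | hw) <;> grind
  refine hK _ (Finset.insert_nonempty _ _) (fun v hv => ?_) fun v hv w hw _ => hpair v hv w hw
  simpa using hpair v hv v hv

/-- The link of an `(n-1)`-simplex is a homology 0-sphere, so Euler's relation gives exactly two
facets containing it. -/
theorem IsClosedHomologyManifold.exists_insert_mem_ne (hK : K.IsClosedHomologyManifold R n)
    (hF : ∀ s, s ∈ F ↔ s ∈ K) {τ : Finset ι} (hc : τ.card = n) {b : ι}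
    (hτ : τ.Nonempty) (hbK : insert b τ ∈ K) :
    ∃ c, c ≠ b ∧ c ∉ τ ∧ insert c τ ∈ K := by
  have hτK := mem_of_subset hbK (Finset.subset_insert b τ) hτ
  have h := hK.euler_cofaces hF hτK (m := 1) (by omega)
  simp only [Finset.sum_range_succ, Finset.sum_range_zero,
    card_cofaces_zero ((hF τ).2 hτK)] at h
  obtain ⟨ρ, hρ, hne⟩ := Finset.exists_mem_ne (s := cofaces F τ 1) (by omega) (insert b τ)
  rw [mem_cofaces, hF] at hρ
  obtain ⟨c, hcτ, rfl⟩ := Finset.exists_eq_insert_iff.2 ⟨hρ.2.1, hρ.2.2.symm⟩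
  exact ⟨c, fun h => hne (by rw [h]), hcτ, hρ.1⟩

/-- A triangle of `K` on vertices of the link of `σ` would, by flagness, join with `σ` to a simplex
on `n + 2` vertices. -/
theorem IsFlag.not_insert_three {ι : Type*} [DecidableEq ι] {K : PreAbstractSimplicialComplex ι}
    (hK : K.IsFlag) (hcard : ∀ s ∈ K, s.card ≤ n + 1) {σ : Finset ι} (hσ : σ.card + 1 = n) {a b c : ι} (hab : a ≠ b)
    (hac : a ≠ c) (hbc : b ≠ c) (ha : a ∉ σ) (hb : b ∉ σ) (hc : c ∉ σ)
    (haK : insert a σ ∈ K) (hbK : insert b σ ∈ K) (hcK : insert c σ ∈ K)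
    (habK : {a, b} ∈ K) (hbcK : {b, c} ∈ K) (hacK : {a, c} ∈ K) : False := by
  have h := hcard _ (hK.insert_three_mem haK hbK hcK habK hbcK hacK)
  rw [Finset.card_insert_of_notMem (by simp [*]), Finset.card_insert_of_notMem (by simp [*]),
    Finset.card_insert_of_notMem hc] at h
  omega

theorem IsFlagNoSquare.five_le_card_cofaces (h : K.IsFlagNoSquare)
    (hK : K.IsClosedHomologyManifold R n) (hF : ∀ s, s ∈ F ↔ s ∈ K) {σ : Finset ι}
    (hσ : σ ∈ K) (hc : σ.card + 1 = n) : 5 ≤ (cofaces F σ 2).card := by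
  have heuler := hK.euler_cofaces hF hσ (m := 2) (by omega)
  simp only [Finset.sum_range_succ, Finset.sum_range_zero,
    card_cofaces_zero ((hF σ).2 hσ)] at heuler
  -- Euler's relation for the link says that it has as many edges as vertices.
  suffices h1 : 5 ≤ (cofaces F σ 1).card by omega
  have next : ∀ {a b : ι}, a ∉ σ → b ∉ σ → a ≠ b → insert a (insert b σ) ∈ K →
      ∃ c, c ≠ b ∧ c ∉ σ ∧ c ≠ a ∧ insert a (insert c σ) ∈ K := by
    intro a b ha hb hab habK
    rw [Finset.insert_comm] at habK
    obtain ⟨c, hcb, hcτ, hcK⟩ := hK.exists_insert_mem_ne hF (τ := insert a σ)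
      (by rw [Finset.card_insert_of_notMem ha]; omega) (Finset.insert_nonempty _ _)
      habK
    rw [Finset.mem_insert, not_or] at hcτ
    exact ⟨c, hcb, hcτ.2, hcτ.1, by rwa [Finset.insert_comm]⟩
  have edge : ∀ {a b : ι}, insert a (insert b σ) ∈ K → {a, b} ∈ K := fun hab =>
    mem_of_subset hab (by intro; simp; tauto) (Finset.insert_nonempty _ _)
  have vert : ∀ {a b : ι}, insert a (insert b σ) ∈ K → insert a σ ∈ K := fun hab =>
    mem_of_subset hab (Finset.insert_subset_insert _ (Finset.subset_insert _ _))
      (Finset.insert_nonempty _ _)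
  have vert' : ∀ {a b : ι}, insert a (insert b σ) ∈ K → insert b σ ∈ K := fun hab =>
    mem_of_subset hab (Finset.subset_insert _ _) (Finset.insert_nonempty _ _)
  obtain ⟨ρ, hρ, hσρ, hρc⟩ := hK.exists_facet hσ
  obtain ⟨a, b, hab, hρ'⟩ := Finset.card_eq_two.1
    (show (ρ \ σ).card = 2 by rw [Finset.card_sdiff_of_subset hσρ]; omega)
  have ha : a ∉ σ := (Finset.mem_sdiff.1 (show a ∈ ρ \ σ by simp [hρ'])).2
  have hb : b ∉ σ := (Finset.mem_sdiff.1 (show b ∈ ρ \ σ by simp [hρ'])).2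
  have habK : insert a (insert b σ) ∈ K := by
    rw [← Finset.sdiff_union_of_subset hσρ, hρ', Finset.insert_union, Finset.singleton_union] at hρ
    exact hρ
  -- Extending the edge `a b` at both ends builds the path `c, b, a, d, e` in the link; it remains
  -- to see that its vertices are distinct.
  obtain ⟨d, hdb, hd, hda, hadK⟩ := next ha hb hab habK
  have hbaK : insert b (insert a σ) ∈ K := by rwa [Finset.insert_comm]
  have hdaK : insert d (insert a σ) ∈ K := by rwa [Finset.insert_comm]
  obtain ⟨c, hca, hc', hcb, hbcK⟩ := next hb ha hab.symm hbaK
  obtain ⟨e, hea, he, hed, hdeK⟩ := next hd ha hda hdaK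
  have haK := vert habK
  have hbK := vert hbcK
  have hcK := vert' hbcK
  have hdK := vert hdeK
  have heK := vert' hdeK
  have habd : {b, d} ∉ K := fun hbd =>
    h.1.not_insert_three hK.card_le hc hab hda.symm hdb.symm ha hb hd haK hbK hdK
      (edge habK) hbd (edge hadK)
  have hcd : c ≠ d := by
    rintro rfl
    exact habd (edge hbcK)
  have heb : e ≠ b := by
    rintro rfl
    exact habd (by rw [Finset.pair_comm]; exact edge hdeK)
  -- If `e = c`, the path closes up to the square `a, b, e, d`; either diagonal creates a forbidden
  -- triangle.
  have hec : e ≠ c := by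
    rintro rfl
    have hsq := h.2 ![a, b, e, d] ?_ ?_
    · rcases hsq with hsq | hsq
      · exact h.1.not_insert_three hK.card_le hc hab hea.symm heb.symm ha hb he haK hbK heK
          (edge habK) (edge hbcK) hsq
      · exact habd hsq
    · intro i j
      fin_cases i <;> fin_cases j <;> first
        | exact fun _ => rfl
        | simp [hab, hea, heb, hed, hda, hdb, hab.symm, hea.symm, heb.symm, hed.symm, hda.symm,
            hdb.symm]
    · intro i
      fin_cases i
      · exact edge habK
      · exact edge hbcK
      · show {e, d} ∈ K
        rw [Finset.pair_comm]
        exact edge hdeK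
      · exact edge hdaK
  have h5 : ({a, b, c, d, e} : Finset ι).card = 5 := by
    rw [Finset.card_insert_of_notMem (by simp [hab, hca.symm, hda.symm, hea.symm]),
      Finset.card_insert_of_notMem (by simp [hcb.symm, hdb.symm, heb.symm]),
      Finset.card_insert_of_notMem (by simp [hcd, hec.symm]),
      Finset.card_pair hed.symm]
  rw [← h5]
  have hmem : ∀ x ∈ ({a, b, c, d, e} : Finset ι), x ∉ σ ∧ insert x σ ∈ K := by
    simp only [Finset.mem_insert, Finset.mem_singleton]
    rintro x (rfl | rfl | rfl | rfl | rfl) <;> constructor <;> assumption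
  refine Finset.card_le_card_of_injOn (fun x => insert x σ) ?_ ?_
  · intro x hx
    rw [Finset.mem_coe, mem_cofaces, hF]
    exact ⟨(hmem x hx).2, Finset.subset_insert _ _, Finset.card_insert_of_notMem (hmem x hx).1⟩
  · intro x hx y _ hxy
    exact (Finset.insert_inj (hmem x hx).1).1 hxy

end FlagNoSquare

end PreAbstractSimplicialComplex

theorem corollary4p4 {R : Type*} [CommRing R] [IsDomain R] {ι : Type*} [LinearOrder ι]
    (n : ℕ) (hn : 5 ≤ n) (K : PreAbstractSimplicialComplex ι)
    (hK : K.IsClosedHomologyManifold R n) :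
    ¬ K.IsRich n ∧ ¬ K.IsFlagNoSquare := by
  obtain ⟨σ, hσ, hc, hlt⟩ := hK.exists_card_cofaces_two_lt hn (F := hK.finite.toFinset)
    fun s => hK.finite.mem_toFinset
  constructor
  · intro h
    have := h.five_le_card_cofaces hK.finite (fun s => hK.finite.mem_toFinset) hσ hc
    omega
  · intro h
    have := h.five_le_card_cofaces hK (fun s => hK.finite.mem_toFinset) hσ hc
    omega
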